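/- Let $\mathcal H$ be an infinite-dimensional separable complex Hilbert space with an orthonormal basis $\{e_j\}_{j\in\mathbb N}$, let $\mathcal E$ be the set of compact operators on $\mathcal H$, let $\mathcal F$ be the family of closed subsets of $\mathbb C$, and let $\Xi:\mathcal E\to\mathcal F$ be given by $\Xi(T)=\sigma(T)$, the spectrum. Then the Solvability Complexity Index of $\Xi$ equals one: \[ \mathrm{SCI}(\Xi)=1 . \] Here the notions are as follows. For $T\in\mathcal E$ put $x_{ij}=\langle Te_j,e_i\rangle$, and let $\Pi_{\mathcal E}$ be the set of all the infinite matrices $\{x_{ij}\}_{i,j\in\mathbb N}$ that arise in this way. A set-valued function of matrix elements *is evaluated by finitely many arithmetic operations and radicals* if there is a deterministic procedure that computes with complex numbers (treated as pairs of real numbers), starting from the matrix elements and rational constants, that uses the operations $+,-,\cdot,/$, $k$-th roots ($k\ge 1$), complex conjugation and comparison of real parts with $0$ (with branching), and that on every admissible input stops after finitely many steps and returns the value of the function as a finite list of the elements of a (possibly empty) finite subset of $\mathbb C$. A *set of estimating functions of order $k\ge1$ for $\Xi$* is a family of functions $\Gamma_{n_1,\dots,n_j}:\Pi_{\mathcal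 E}\to\mathcal F$, for $1\le j\le k$ and $n_1,\dots,n_j\in\mathbb N$, such that 1. for each $(n_1,\dots,n_k)$ there is an integer $N=N(n_1,\dots,n_k)$, independent of the matrix, such that $\Gamma_{n_1,\dots,n_k}(\{x_{ij}\})$ depends only on the elements $x_{ij}$ with $i,j\le N$ and is evaluated by finitely many arithmetic operations and radicals of them; 2. for every $T\in\mathcal E$ with matrix $\{x_{ij}\}$, $\Xi(T)=\lim_{n_1\to\infty}\Gamma_{n_1}(\{x_{ij}\})$ and $\Gamma_{n_1,\dots,n_{j}}(\{x_{ij}\})=\lim_{n_{j+1}\to\infty}\Gamma_{n_1,\dots,n_{j+1}}(\{x_{ij}\})$ for $1\le j<k$, all limits being in the Attouch–Wets metric \[ d_{\mathrm{AW}}(\Sigma,\Lambda)=\sum_{i=1}^\infty 2^{-i}\min\Bigl\{1,\sup_{|x|<i}\bigl|d(x,\Sigma)-d(x,\Lambda)\bigr|\Bigr\},\qquad d(x,\Sigma)=\inf_{\rho\in\Sigma}|x-\rho| \] (with $d(x,\emptyset)=\infty$ and $|\infty-\infty|=0$). Finally, $\mathrm{SCI}(\Xi)=0$ if $\Xi(T)$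 itself is evaluated by finitely many arithmetic operations and radicals of finitely many of the matrix elements $x_{ij}$ of $T$; otherwise $\mathrm{SCI}(\Xi)$ is the smallest $k\ge1$ for which there is a set of estimating functions of order $k$ for $\Xi$, and $\infty$ if there is none. -/

import Mathlib

open Filter Topology TopologicalSpace
open scoped ENNReal

noncomputable section

namespace SolvabilityComplexity

/-! ### Attouch–Wets distance -/

/-- The Attouch–Wets distance
`∑_{i ≥ 1} 2^{-i} min {1, sup_{|x| < i} |d(x, A) - d(x, B)|}` of closed subsets of `ℂ`.
Everything lives in `[0, ∞]`, so that `d(x, ∅) = ∞`; the absolute value of a difference is written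
as the larger of the two truncated differences (in particular `|∞ - ∞| = 0`). -/
def attouchWets (A B : Closeds ℂ) : ℝ≥0∞ :=
  ∑' i : ℕ, (2⁻¹ : ℝ≥0∞) ^ (i + 1) *
    min 1 (⨆ x ∈ Metric.ball (0 : ℂ) (i + 1),
      max (Metric.infEDist x (A : Set ℂ) - Metric.infEDist x (B : Set ℂ))
        (Metric.infEDist x (B : Set ℂ) - Metric.infEDist x (A : Set ℂ)))

/-- Convergence of a sequence of closed sets in the Attouch–Wets distance. -/
def AWTendsto (A : ℕ → Closeds ℂ) (B : Closeds ℂ) : Prop :=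
  Tendsto (fun n => attouchWets (A n) B) atTop (𝓝 0)

/-! ### Evaluation by finitely many arithmetic operations and radicals -/

/-- Expressions built from complex inputs (indexed by `ι`) and rational numbers by finitely many
arithmetic operations, radicals, and complex conjugation.  Conjugation gives access to real and
imaginary parts, i.e. a complex number is treated as a pair of real numbers. -/
inductive RadicalExpr (ι : Type) : Type
  | entry (p : ι) : RadicalExpr ι
  | rat (q : ℚ) : RadicalExpr ι
  | add (s t : RadicalExpr ι) : RadicalExpr ι
  | sub (s t : RadicalExpr ι) : RadicalExpr ι
  | mul (s t : RadicalExpr ι) : RadicalExpr ι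
  | div (s t : RadicalExpr ι) : RadicalExpr ι
  | conj (t : RadicalExpr ι) : RadicalExpr ι
  | root (k : ℕ+) (t : RadicalExpr ι) : RadicalExpr ι

/-- The value of an expression.  `root k` is the principal `k`-th root; the other `k`-th roots are
obtained by multiplying with roots of unity, which are themselves products of principal roots of
`-1`.  Division by zero returns `0`: as an algorithm may test whether a number vanishes before it
divides, this convention does not affect what can be evaluated. -/
def RadicalExpr.eval {ι : Type} (x : ι → ℂ) : RadicalExpr ι → ℂ
  | .entry p => x p
  | .rat q => (q : ℂ)
  | .add s t => s.eval x + t.eval x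
  | .sub s t => s.eval x - t.eval x
  | .mul s t => s.eval x * t.eval x
  | .div s t => s.eval x / t.eval x
  | .conj t => (starRingEnd ℂ) (t.eval x)
  | .root k t => (t.eval x) ^ (((k : ℕ) : ℂ)⁻¹)

/-- One instruction of an algorithm: either compare the real part of a computed number with `0`,
or stop and return a finite list of computed numbers. -/
inductive Instruction (ι : Type) : Type
  | test (t : RadicalExpr ι) : Instruction ι
  | output (l : List (RadicalExpr ι)) : Instruction ι

/-- An algorithm is a binary decision tree; a vertex of the tree is addressed by the list of
outcomes of the tests on the way from the root to it (the most recent outcome comes first). -/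
def Algorithm (ι : Type) : Type := List Bool → Instruction ι

/-- `p.Run x h S`: on the input `x`, starting at the vertex `h`, the algorithm `p` stops after
finitely many steps, and the finite set of numbers that it returns is `S`. -/
inductive Algorithm.Run {ι : Type} (p : Algorithm ι) (x : ι → ℂ) : List Bool → Set ℂ → Prop
  | output (h : List Bool) (l : List (RadicalExpr ι)) (hp : p h = Instruction.output l) :
      Algorithm.Run p x h {z | ∃ t ∈ l, t.eval x = z}
  | pos (h : List Bool) (t : RadicalExpr ι) (S : Set ℂ) (hp : p h = Instruction.test t)
      (ht : 0 < (t.eval x).re) (hS : Algorithm.Run p x (true :: h) S) : Algorithm.Run p x h S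
  | nonpos (h : List Bool) (t : RadicalExpr ι) (S : Set ℂ) (hp : p h = Instruction.test t)
      (ht : (t.eval x).re ≤ 0) (hS : Algorithm.Run p x (false :: h) S) : Algorithm.Run p x h S

/-- On the input `x`, the algorithm `p` stops after finitely many steps and returns `S`. -/
def Algorithm.Evaluates {ι : Type} (p : Algorithm ι) (x : ι → ℂ) (S : Set ℂ) : Prop :=
  p.Run x [] S

/-! ### The Solvability Complexity Index -/

variable {H : Type*} [NormedAddCommGroup H] [InnerProductSpace ℂ H]

/-- The matrix elements `x i j = ⟨T e_j, e_i⟩` (linear in `T e_j`) in the orthonormal basis `e`. -/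
def matrixElements (e : HilbertBasis ℕ ℂ H) (T : H →L[ℂ] H) : ℕ → ℕ → ℂ :=
  fun i j => inner ℂ (e i) (T (e j))

/-- The set of the infinite matrices of the operators in `E`. -/
def matrixSet (e : HilbertBasis ℕ ℂ H) (E : Set (H →L[ℂ] H)) : Set (ℕ → ℕ → ℂ) :=
  matrixElements e '' E

/-- The matrix of an element of `E`, as an element of `matrixSet e E`. -/
def matrixOf (e : HilbertBasis ℕ ℂ H) {E : Set (H →L[ℂ] H)} (T : E) : matrixSet e E :=
  ⟨matrixElements e (T : H →L[ℂ] H), ⟨(T : H →L[ℂ] H), T.2, rfl⟩⟩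

/-- `Γ` is a set of estimating functions of order `k` (for `1 ≤ k`) for `Ξ`.  The function
`Γ_{n₁, …, n_j}` is `Γ [n₁, …, n_j]` for `1 ≤ j ≤ k`; moreover `Γ []` stands for `Ξ` itself, read
as a function of the matrix elements, and `Γ l` plays no role for lists longer than `k`. -/
structure IsEstimatingFamily (e : HilbertBasis ℕ ℂ H) (E : Set (H →L[ℂ] H))
    (Ξ : E → Closeds ℂ) (k : ℕ) (Γ : List ℕ → matrixSet e E → Closeds ℂ) : Prop where
  /-- `Γ_{n₁, …, n_k}` only uses the elements `x i j` with `i, j < N`, where `N` depends on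
  `n₁, …, n_k` only, and is evaluated by arithmetic operations and radicals of them. -/
  evaluation : ∀ l : List ℕ, l.length = k →
    ∃ (N : ℕ) (p : Algorithm (Fin N × Fin N)), ∀ x : matrixSet e E,
      p.Evaluates (fun q => x.1 q.1 q.2) (Γ l x : Set ℂ)
  /-- `Γ_{n₁, …, n_j}` is the limit of `Γ_{n₁, …, n_j, n}` as `n → ∞`, for `0 ≤ j < k`. -/
  limit : ∀ l : List ℕ, l.length < k → ∀ x : matrixSet e E,
    AWTendsto (fun n => Γ (l ++ [n]) x) (Γ l x)
  /-- The outermost limit is `Ξ`. -/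
  target : ∀ T : E, Γ [] (matrixOf e T) = Ξ T

/-- `Ξ` is solvable with `k` limits: for `k = 0`, the set `Ξ T` itself is evaluated by finitely many
arithmetic operations and radicals of finitely many matrix elements of `T`; for `1 ≤ k`, there is a
set of estimating functions of order `k` for `Ξ`. -/
def SolvableWithLimits (e : HilbertBasis ℕ ℂ H) (E : Set (H →L[ℂ] H)) (Ξ : E → Closeds ℂ) :
    ℕ → Prop
  | 0 => ∃ p : Algorithm (ℕ × ℕ), ∀ T : E,
      p.Evaluates (fun q => matrixElements e (T : H →L[ℂ] H) q.1 q.2) (Ξ T : Set ℂ)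
  | k + 1 => ∃ Γ : List ℕ → matrixSet e E → Closeds ℂ, IsEstimatingFamily e E Ξ (k + 1) Γ

/-- The Solvability Complexity Index of `Ξ`: the smallest `k` such that `Ξ` is solvable with `k`
limits, and `⊤` if there is no such `k`. -/
def SCI (e : HilbertBasis ℕ ℂ H) (E : Set (H →L[ℂ] H)) (Ξ : E → Closeds ℂ) : ℕ∞ :=
  ⨅ (k : ℕ) (_ : SolvableWithLimits e E Ξ k), (k : ℕ∞)

/-- The spectrum of a bounded operator as a closed subset of `ℂ`. -/
def closedSpectrum [CompleteSpace H] (T : H →L[ℂ] H) : Closeds ℂ :=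
  ⟨spectrum ℂ T, spectrum.isClosed T⟩

end SolvabilityComplexity

end

/-!
Let `P n` be the projection onto the span of the first `n` basis vectors and let `T` be compact.
Then `P n * T` converges to `T` in norm, and the nonzero spectrum of `P n * T` consists of
eigenvalues of the finite section of size `n`. A nonzero point of the spectrum of `T` is isolated,
so it is approached by eigenvalues of the finite sections (by the maximum principle for the
resolvent); conversely an approximate eigenvector of a finite section is one of `T`, so its
approximate eigenvalue is close to the spectrum of `T`. Being an approximate eigenvalue can be
decided on the points `z` of a grid by comparing the determinant and the adjugate of
`z - P n * T * P n`, which takes arithmetic operations only.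

No single algorithm computes the spectrum, because the run on the zero matrix inspects finitely many
matrix elements and so cannot tell `0` from a rank-one projection onto a late basis vector.
-/

noncomputable section

namespace SolvabilityComplexity

/-! ### Algorithms -/

section Algorithms

variable {ι : Type}

/-- The functions of the inputs that are values of radical expressions. They form a star algebra, so
that sums, products and determinants of such functions can be formed by ring operations. -/
def expressible (ι : Type) : StarSubalgebra ℚ ((ι → ℂ) → ℂ) where
  carrier := {f | ∃ t : RadicalExpr ι, ∀ x, t.eval x = f x}
  add_mem' := by
    rintro f g ⟨s, hs⟩ ⟨t, ht⟩
    exact ⟨.add s t, fun x => congrArg₂ (· + ·) (hs x) (ht x)⟩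
  mul_mem' := by
    rintro f g ⟨s, hs⟩ ⟨t, ht⟩
    exact ⟨.mul s t, fun x => congrArg₂ (· * ·) (hs x) (ht x)⟩
  algebraMap_mem' q := ⟨.rat q, fun _ => rfl⟩
  star_mem' := by
    rintro f ⟨t, ht⟩
    exact ⟨.conj t, fun x => congrArg (starRingEnd ℂ) (ht x)⟩

theorem proj_mem_expressible (p : ι) : (fun x => x p) ∈ expressible ι := ⟨.entry p, fun _ => rfl⟩

theorem const_I_mem_expressible : Function.const _ Complex.I ∈ expressible ι := by
  refine ⟨.root 2 (.rat (-1)), fun x => ?_⟩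
  have sqrt_neg_one : (-1 : ℂ) ^ (2 : ℂ)⁻¹ = Complex.I := by
    rw [Complex.cpow_def_of_ne_zero (by norm_num), Complex.log_neg_one, ← div_eq_mul_inv,
      mul_div_right_comm]
    exact Complex.exp_pi_div_two_mul_I
  simpa [RadicalExpr.eval] using sqrt_neg_one

/-- Evaluation of expressible functions at an input `x`. -/
def evalAt (x : ι → ℂ) : expressible ι →⋆ₐ[ℚ] ℂ :=
  (Pi.evalStarAlgHom ℚ (fun _ => ℂ) x).comp (expressible ι).subtype

theorem evalAt_mk (x : ι → ℂ) {f : (ι → ℂ) → ℂ} (hf : f ∈ expressible ι) :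
    evalAt x ⟨f, hf⟩ = f x := rfl

namespace Algorithm

/-- The algorithm that tests `t` and then continues with `p` or with `q`. -/
def branch (t : RadicalExpr ι) (p q : Algorithm ι) : Algorithm ι := fun h =>
  match h.getLast? with
  | none => .test t
  | some true => p h.dropLast
  | some false => q h.dropLast

theorem branch_append_true (t : RadicalExpr ι) (p q : Algorithm ι) (h : List Bool) :
    branch t p q (h ++ [true]) = p h := by
  simp [branch]

theorem branch_append_false (t : RadicalExpr ι) (p q : Algorithm ι) (h : List Bool) :
    branch t p q (h ++ [false]) = q h := by
  simp [branch]

variable {p q r : Algorithm ι} {t : RadicalExpr ι} {x : ι → ℂ} {h : List Bool} {S S' : Set ℂ}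

theorem Run.append (b : Bool) (hr : ∀ h, r (h ++ [b]) = p h) (H : p.Run x h S) :
    r.Run x (h ++ [b]) S := by
  induction H with
  | output h l hp => exact .output _ l ((hr h).trans hp)
  | pos h t S hp ht _ ih => exact .pos _ t S ((hr h).trans hp) ht ih
  | nonpos h t S hp ht _ ih => exact .nonpos _ t S ((hr h).trans hp) ht ih

theorem Evaluates.branch_of_pos (ht : 0 < (t.eval x).re) (H : p.Evaluates x S) :
    (branch t p q).Evaluates x S :=
  .pos [] t S rfl ht (Run.append (h := []) true (branch_append_true t p q) H)

theorem Evaluates.branch_of_nonpos (ht : (t.eval x).re ≤ 0) (H : q.Evaluates x S) :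
    (branch t p q).Evaluates x S :=
  .nonpos [] t S rfl ht (Run.append (h := []) false (branch_append_false t p q) H)

theorem exists_evaluates_union_selection (l : List (RadicalExpr ι)) {α : Type*} (L : List α)
    (c v : α → expressible ι) :
    ∃ p : Algorithm ι, ∀ x, p.Evaluates x
      ({z | ∃ t ∈ l, t.eval x = z} ∪
        {z | ∃ a ∈ L, (evalAt x (c a)).re ≤ 0 ∧ evalAt x (v a) = z}) := by
  induction L generalizing l with
  | nil =>
    refine ⟨fun _ => .output l, fun x => ?_⟩
    simpa using! Run.output (p := fun _ => .output l) (x := x) [] l rfl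
  | cons a L ih =>
    obtain ⟨s, hs⟩ : ∃ s : RadicalExpr ι, ∀ x, s.eval x = evalAt x (c a) := (c a).2
    obtain ⟨t, ht⟩ : ∃ t : RadicalExpr ι, ∀ x, t.eval x = evalAt x (v a) := (v a).2
    obtain ⟨p, hp⟩ := ih l
    obtain ⟨q, hq⟩ := ih (t :: l)
    refine ⟨branch s p q, fun x => ?_⟩
    rcases lt_or_ge 0 (s.eval x).re with h | h
    · convert (hp x).branch_of_pos h using 1
      simp [← hs, h.not_ge]
    · convert (hq x).branch_of_nonpos h using 1
      ext z
      simp only [List.mem_cons, exists_eq_or_imp, Set.mem_union, Set.mem_ofPred_eq, h, true_and,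
        ← hs, ← ht]
      rw [or_left_comm, or_assoc]

theorem Run.unique (H : p.Run x h S) (H' : p.Run x h S') : S = S' := by
  induction H with
  | output h l hp => cases H' <;> simp_all
  | pos h t S hp ht _ ih => cases H' <;> grind
  | nonpos h t S hp ht _ ih => cases H' <;> grind

end Algorithm

-- The filter `Filter.pi fun i => pure (x i)` expresses agreement with `x` at finitely many indices.
theorem RadicalExpr.eventually_eval_eq (t : RadicalExpr ι) (x : ι → ℂ) :
    ∀ᶠ y in Filter.pi fun i => pure (x i), t.eval y = t.eval x := by
  induction t with
  | entry p => exact tendsto_pure.1 (tendsto_eval_pi (fun i => pure (x i)) p)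
  | rat q => exact .of_forall fun _ => rfl
  | add s t hs ht | sub s t hs ht | mul s t hs ht | div s t hs ht =>
    filter_upwards [hs, ht] with y hsy hty
    simp only [RadicalExpr.eval, hsy, hty]
  | conj t ht | root k t ht =>
    filter_upwards [ht] with y hty
    simp only [RadicalExpr.eval, hty]

theorem Algorithm.Run.eventually {p : Algorithm ι} {x : ι → ℂ} {h : List Bool} {S : Set ℂ}
    (H : p.Run x h S) : ∀ᶠ y in Filter.pi fun i => pure (x i), p.Run y h S := by
  induction H with
  | output h l hp =>
    filter_upwards [(eventually_all_finite l.finite_toSet).2 fun t _ => t.eventually_eval_eq x]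
      with y hy
    have : {z | ∃ t ∈ l, t.eval y = z} = {z | ∃ t ∈ l, t.eval x = z} :=
      Set.ext fun z => exists_congr fun t => and_congr_right fun ht => by rw [hy t ht]
    exact this ▸ .output h l hp
  | pos h t S hp ht _ ih =>
    filter_upwards [ih, t.eventually_eval_eq x] with y hy hty
    exact .pos h t S hp (hty ▸ ht) hy
  | nonpos h t S hp ht _ ih =>
    filter_upwards [ih, t.eventually_eval_eq x] with y hy hty
    exact .nonpos h t S hp (hty ▸ ht) hy

end Algorithms

/-! ### Compact operators and perturbation of the spectrum -/

section CompactOperators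

variable {𝕜 X : Type*} [NontriviallyNormedField 𝕜] [NormedAddCommGroup X] [NormedSpace 𝕜 X]

theorem exists_bounded_separated_of_strictMono {V : ℕ → Submodule 𝕜 X} (hV : StrictMono V)
    (hVc : ∀ n, IsClosed (V n : Set X)) :
    ∃ (R : ℝ) (x : ℕ → X), ∀ n, x n ∈ V (n + 1) ∧ ‖x n‖ ≤ R ∧ ∀ y ∈ V n, 1 ≤ ‖x n - y‖ := by
  obtain ⟨a, ha⟩ := NormedField.exists_one_lt_norm 𝕜
  obtain ⟨R, hR⟩ := exists_gt ‖a‖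
  suffices ∀ n, ∃ x ∈ V (n + 1), ‖x‖ ≤ R ∧ ∀ y ∈ V n, 1 ≤ ‖x - y‖ by
    choose x hx using this
    exact ⟨R, x, hx⟩
  intro n
  obtain ⟨w, hw, hwn⟩ := SetLike.exists_of_lt (hV n.lt_succ_self)
  have comap_closed : IsClosed ((V n).comap (V (n + 1)).subtype : Set (V (n + 1))) :=
    (hVc n).preimage continuous_subtype_val
  obtain ⟨x, hxR, hx⟩ := riesz_lemma_of_norm_lt ha hR comap_closed ⟨⟨w, hw⟩, hwn⟩
  exact ⟨x, x.2, hxR, fun y hy => hx ⟨y, hV.monotone n.le_succ hy⟩ hy⟩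

theorem exists_norm_lt_of_isCompactOperator {T : X →L[𝕜] X} (hT : IsCompactOperator T)
    {V : ℕ → Submodule 𝕜 X} (hV : StrictMono V) (hVc : ∀ n, IsClosed (V n : Set X)) {μ : ℕ → 𝕜}
    (hμ : ∀ n, ∀ x ∈ V (n + 1), T x - μ n • x ∈ V n) {c : ℝ} (hc : 0 < c) : ∃ n, ‖μ n‖ < c := by
  by_contra! hcμ
  obtain ⟨R, x, hx⟩ := exists_bounded_separated_of_strictMono hV hVc
  choose hxV hxR hx using hx
  have separated {j k : ℕ} (hjk : j < k) : c ≤ ‖T (x k) - T (x j)‖ := by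
    have hTxj : T (x j) ∈ V k := hV.monotone hjk <| by
      simpa using add_mem (hV.monotone j.le_succ (hμ j _ (hxV j)))
        ((V (j + 1)).smul_mem (μ j) (hxV j))
    have hμk : μ k ≠ 0 := norm_pos_iff.1 (hc.trans_le (hcμ k))
    set y := (μ k)⁻¹ • (T (x j) - (T (x k) - μ k • x k)) with hy
    have hyV : y ∈ V k := (V k).smul_mem _ (sub_mem hTxj (hμ k _ (hxV k)))
    calc c ≤ ‖μ k‖ * ‖x k - y‖ :=
          (hcμ k).trans (le_mul_of_one_le_right (norm_nonneg _) (hx k y hyV))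
      _ = ‖T (x k) - T (x j)‖ := by
        rw [← norm_smul, smul_sub, hy, smul_inv_smul₀ hμk]
        congr 1
        abel
  obtain ⟨K, hK, hKT⟩ := hT.image_closedBall_subset_compact R
  obtain ⟨_, -, φ, hφ, hlim⟩ := hK.tendsto_subseq fun n =>
    hKT ⟨x n, mem_closedBall_zero_iff.2 (hxR n), rfl⟩
  obtain ⟨N, hN⟩ := Metric.cauchySeq_iff'.1 hlim.cauchySeq c hc
  exact (separated (hφ N.lt_succ_self)).not_gt (by simpa [dist_eq_norm] using hN _ N.le_succ)

theorem finite_setOf_hasEigenvalue_of_isCompactOperator [CompleteSpace 𝕜] {T : X →L[𝕜] X}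
    (hT : IsCompactOperator T) {c : ℝ} (hc : 0 < c) :
    {μ | Module.End.HasEigenvalue (T : Module.End 𝕜 X) μ ∧ c ≤ ‖μ‖}.Finite := by
  by_contra hinf
  let f := Set.Infinite.natEmbedding _ hinf
  choose v hv using fun n => (f n).2.1.exists_hasEigenvector
  have hvli : LinearIndependent 𝕜 v := Module.End.eigenvectors_linearIndependent' _
    (fun n => (f n : 𝕜)) (Subtype.val_injective.comp f.injective) v hv
  let V : ℕ → Submodule 𝕜 X := fun n => Submodule.span 𝕜 (v '' Set.Iio n)
  have V_strictMono : StrictMono V := strictMono_nat_of_lt_succ fun n =>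
    SetLike.lt_iff_le_and_exists.2 ⟨Submodule.span_mono (by gcongr; exact n.le_succ), v n,
      Submodule.subset_span ⟨n, n.lt_succ_self, rfl⟩, hvli.notMem_span_image (by simp)⟩
  have V_closed (n : ℕ) : IsClosed (V n : Set X) := by
    have := FiniteDimensional.span_of_finite 𝕜 ((Set.finite_Iio n).image v)
    exact Submodule.closed_of_finiteDimensional (V n)
  have shift (n : ℕ) :
      V (n + 1) ≤ (V n).comap ((T - (f n : 𝕜) • .id 𝕜 X : X →L[𝕜] X) : X →ₗ[𝕜] X) := by
    rw [Submodule.span_le]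
    rintro _ ⟨j, hj, rfl⟩
    have hTv : T (v j) - (f n : 𝕜) • v j = ((f j : 𝕜) - f n) • v j := by
      simpa [sub_smul] using (hv j).apply_eq_smul
    obtain hjn | rfl := (Nat.lt_succ_iff.1 hj).lt_or_eq
    · simpa [hTv] using (V n).smul_mem _ (Submodule.subset_span ⟨j, hjn, rfl⟩)
    · simp [hTv]
  obtain ⟨n, hn⟩ := exists_norm_lt_of_isCompactOperator hT V_strictMono V_closed
    (fun n x hx => by simpa using shift n hx) hc
  exact hn.not_ge (f n).2.2

theorem zero_mem_spectrum_of_isCompactOperator [CompleteSpace 𝕜] (hX : ¬ FiniteDimensional 𝕜 X)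
    {T : X →L[𝕜] X} (hT : IsCompactOperator T) : 0 ∈ spectrum 𝕜 T := by
  rw [spectrum.zero_mem_iff]
  intro hunit
  obtain ⟨S, hST⟩ := hunit.exists_left_inv
  have hid : S ∘ T = id := funext fun x => congr($hST x)
  exact hX (.of_isCompactOperator_id (hid ▸ hT.clm_comp S))

end CompactOperators

section ResolventPerturbation

variable {𝕜 A : Type*} [NormedField 𝕜] [NormedRing A] {a b : A}

theorem norm_resolvent_le_two_mul [NormedAlgebra 𝕜 A] {z : 𝕜} {C : ℝ} (ha : z ∈ resolventSet 𝕜 a)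
    (hb : z ∈ resolventSet 𝕜 b) (hC : ‖resolvent a z‖ ≤ C) (hab : ‖b - a‖ * C ≤ 1 / 2) :
    ‖resolvent b z‖ ≤ 2 * C := by
  have hprod : ‖resolvent b z - resolvent a z‖ ≤ ‖resolvent b z‖ * (1 / 2) := calc
    _ = ‖resolvent b z * (b - a) * resolvent a z‖ := by
      rw [spectrum.resolvent_sub_resolvent hb ha]
    _ ≤ ‖resolvent b z‖ * (‖b - a‖ * ‖resolvent a z‖) := by
      rw [mul_assoc]
      exact (norm_mul_le _ _).trans (by gcongr; exact norm_mul_le _ _)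
    _ ≤ ‖resolvent b z‖ * (1 / 2) := by
      gcongr
      exact (mul_le_mul_of_nonneg_left hC (norm_nonneg _)).trans hab
  linarith [norm_le_norm_add_norm_sub' (resolvent b z) (resolvent a z)]

theorem mem_resolventSet_of_norm_sub_mul_norm_resolvent_lt_one [NormedAlgebra 𝕜 A]
    [CompleteSpace A] {z : 𝕜} (hb : z ∈ resolventSet 𝕜 b) (hab : ‖b - a‖ * ‖resolvent b z‖ < 1) :
    z ∈ resolventSet 𝕜 a := by
  nontriviality A
  obtain ⟨u, hu⟩ := spectrum.mem_resolventSet_iff.1 hb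
  rw [resolvent, ← hu, Ring.inverse_unit] at hab
  have hua : ‖algebraMap 𝕜 A z - a - u‖ < ‖(↑u⁻¹ : A)‖⁻¹ := by
    rwa [hu, sub_sub_sub_cancel_left, ← one_div, lt_div_iff₀ (Units.norm_pos _)]
  exact ⟨Units.ofNearby u _ hua, rfl⟩

theorem norm_resolvent_le_of_forall_mem_sphere [NormedAlgebra ℂ A] [CompleteSpace A] {z : ℂ}
    {r C : ℝ} (hr : 0 < r) (hb : Metric.closedBall z r ⊆ resolventSet ℂ b)
    (hC : ∀ w ∈ Metric.sphere z r, ‖resolvent b w‖ ≤ C) : ‖resolvent b z‖ ≤ C := by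
  refine Complex.norm_le_of_forall_mem_frontier_norm_le (U := Metric.ball z r)
    Metric.isBounded_ball (DifferentiableOn.diffContOnCl fun w hw => ?_)
    (by rwa [frontier_ball z hr.ne']) (subset_closure (Metric.mem_ball_self hr))
  rw [closure_ball z hr.ne'] at hw
  exact (spectrum.hasDerivAt_resolvent_const_left
    (hb hw)).differentiableAt.differentiableWithinAt

theorem eventually_exists_mem_spectrum_dist_le [NormedAlgebra ℂ A] [CompleteSpace A] {z : ℂ} {r : ℝ}
    (hz : z ∈ spectrum ℂ a) (hr : 0 < r) (hrs : Metric.sphere z r ⊆ resolventSet ℂ a) :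
    ∀ᶠ b in 𝓝 a, ∃ w ∈ spectrum ℂ b, dist w z ≤ r := by
  have hcont : ContinuousOn (resolvent a) (Metric.sphere z r) := fun w hw =>
    (spectrum.hasDerivAt_resolvent_const_left (hrs hw)).continuousAt.continuousWithinAt
  obtain ⟨C, hC⟩ := (isCompact_sphere z r).exists_bound_of_continuousOn hcont
  have hsmall : ∀ᶠ b in 𝓝 a, ‖b - a‖ * C < 1 / 2 := by
    have : Tendsto (fun b => ‖b - a‖ * C) (𝓝 a) (𝓝 (‖a - a‖ * C)) :=
      Continuous.tendsto (by fun_prop) a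
    exact this.eventually_lt_const (by simp)
  filter_upwards [hsmall] with b hab
  by_contra! hfar
  have hb : Metric.closedBall z r ⊆ resolventSet ℂ b := fun w hw => by
    by_contra hwb
    exact (hfar w hwb).not_ge hw
  have hcenter : ‖resolvent b z‖ ≤ 2 * C := norm_resolvent_le_of_forall_mem_sphere hr hb fun w hw =>
    norm_resolvent_le_two_mul (hrs hw) (hb (Metric.sphere_subset_closedBall hw)) (hC w hw) hab.le
  refine hz (mem_resolventSet_of_norm_sub_mul_norm_resolvent_lt_one
    (hb (Metric.mem_closedBall_self hr.le)) ?_)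
  linarith [mul_le_mul_of_nonneg_left hcenter (norm_nonneg (b - a))]

end ResolventPerturbation

theorem mem_spectrum_of_hasEigenvalue {𝕜 X : Type*} [NormedField 𝕜] [NormedAddCommGroup X]
    [NormedSpace 𝕜 X] {T : X →L[𝕜] X} {z : 𝕜}
    (hz : Module.End.HasEigenvalue (T : Module.End 𝕜 X) z) : z ∈ spectrum 𝕜 T :=
  fun hunit => hz.mem_spectrum (hunit.map ContinuousLinearMap.toLinearMapRingHom)

theorem exists_pos_forall_approx_eigenvector_mem_thickening_spectrum {𝕜 X : Type*} [RCLike 𝕜]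
    [NormedAddCommGroup X] [NormedSpace 𝕜 X] [CompleteSpace X] (T : X →L[𝕜] X) {δ : ℝ}
    (hδ : 0 < δ) : ∃ ε > 0, ∀ (z : 𝕜) (u : X), u ≠ 0 → ‖T u - z • u‖ ≤ ε * ‖u‖ →
      z ∈ Metric.thickening δ (spectrum 𝕜 T) := by
  have near : ∀ᶠ S in 𝓝 T, spectrum 𝕜 S ⊆ Metric.thickening δ (spectrum 𝕜 T) :=
    upperHemicontinuousAt_iff_forall_isOpen.1
      (upperHemicontinuous_iff.1 (upperHemicontinuous_spectrum 𝕜 (X →L[𝕜] X)) T) _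
      Metric.isOpen_thickening (Metric.self_subset_thickening hδ _)
  obtain ⟨ε, hε, hball⟩ := Metric.nhds_basis_closedBall.eventually_iff.1 near
  refine ⟨ε, hε, fun z u hu hzu => ?_⟩
  have hu' : ‖u‖ ≠ 0 := norm_ne_zero_iff.2 hu
  obtain ⟨g, hg, hgu⟩ := exists_dual_vector 𝕜 u hu'
  -- A rank-one perturbation of `T` turns the approximate eigenvector into an eigenvector.
  let S : X →L[𝕜] X := T - ((‖u‖⁻¹ : 𝕜) • g).smulRight (T u - z • u)
  have hST : ‖S - T‖ ≤ ε := by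
    simpa [S, ContinuousLinearMap.norm_smulRight_apply, norm_smul, hg, inv_mul_le_iff₀,
      norm_pos_iff.2 hu, mul_comm] using hzu
  have hSu : S u = z • u := by simp [S, hgu, hu]
  have hev : Module.End.HasEigenvalue (S : Module.End 𝕜 X) z :=
    Module.End.hasEigenvalue_of_hasEigenvector ⟨Module.End.mem_eigenspace_iff.2 hSu, hu⟩
  exact hball (mem_closedBall_iff_norm.2 hST) (mem_spectrum_of_hasEigenvalue hev)

section CompactSpectrum

variable {X : Type*} [NormedAddCommGroup X] [NormedSpace ℂ X] [CompleteSpace X] {T : X →L[ℂ] X}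

theorem finite_setOf_mem_spectrum_of_isCompactOperator (hT : IsCompactOperator T) {c : ℝ}
    (hc : 0 < c) : {μ ∈ spectrum ℂ T | c ≤ ‖μ‖}.Finite :=
  (finite_setOf_hasEigenvalue_of_isCompactOperator hT hc).subset fun _ hμ =>
    ⟨(hT.hasEigenvalue_iff_mem_spectrum (norm_pos_iff.1 (hc.trans_le hμ.2))).2 hμ.1, hμ.2⟩

theorem eventually_exists_mem_spectrum_dist_lt (hT : IsCompactOperator T) {z : ℂ}
    (hz : z ∈ spectrum ℂ T) (hz0 : z ≠ 0) {δ : ℝ} (hδ : 0 < δ) :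
    ∀ᶠ S in 𝓝 T, ∃ w ∈ spectrum ℂ S, dist w z < δ := by
  have hz' : 0 < ‖z‖ / 2 := half_pos (norm_pos_iff.2 hz0)
  obtain ⟨r, ⟨hr0, hr⟩, hr_avoid⟩ := ((Set.Ioo_infinite (lt_min hδ hz')).sdiff
    ((finite_setOf_mem_spectrum_of_isCompactOperator hT hz').image fun w => dist w z)).nonempty
  obtain ⟨hrδ, hrz⟩ := lt_min_iff.1 hr
  have sphere_subset : Metric.sphere z r ⊆ resolventSet ℂ T := fun w hw => by
    by_contra hwT
    refine hr_avoid ⟨w, ⟨hwT, ?_⟩, hw⟩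
    have : ‖z‖ ≤ ‖w‖ + dist w z := by
      rw [dist_eq_norm']
      exact norm_le_norm_add_norm_sub' z w
    linarith [Metric.mem_sphere.1 hw]
  filter_upwards [eventually_exists_mem_spectrum_dist_le hz hr0 sphere_subset]
  rintro S ⟨w, hw, hwz⟩
  exact ⟨w, hw, hwz.trans_lt hrδ⟩

end CompactSpectrum

section StrongConvergence

variable {𝕜 X Y Z : Type*} [NontriviallyNormedField 𝕜] [NormedAddCommGroup X] [NormedSpace 𝕜 X]
  [NormedAddCommGroup Y] [NormedSpace 𝕜 Y] [CompleteSpace Y] [NormedAddCommGroup Z]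
  [NormedSpace 𝕜 Z] {P : ℕ → Y →L[𝕜] Z} {Q : Y →L[𝕜] Z}

theorem tendstoUniformlyOn_of_forall_tendsto_of_isCompact
    (hP : ∀ y, Tendsto (fun n => P n y) atTop (𝓝 (Q y))) {M : Set Y} (hM : IsCompact M) :
    TendstoUniformlyOn (fun n => P n) Q atTop M := by
  have bounded : ∃ C, ∀ n, ‖P n‖ ≤ C := banach_steinhaus fun y =>
    (hP y).norm.bddAbove_range.imp fun _ hC n => hC ⟨n, rfl⟩
  have equicontinuous : Equicontinuous ((↑) ∘ P : ℕ → Y → Z) :=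
    ((NormedSpace.equicontinuous_TFAE P).out 1 5).2 bounded
  refine UniformOnFun.tendsto_iff_tendstoUniformlyOn.1
    ((EquicontinuousOn.tendsto_uniformOnFun_iff_pi' (𝔖 := {M}) (by simpa) (fun M _ =>
      equicontinuous.equicontinuousOn M) atTop Q).2 ?_) M rfl
  exact tendsto_pi_nhds.2 fun y => hP y

theorem tendsto_comp_of_isCompactOperator (hP : ∀ y, Tendsto (fun n => P n y) atTop (𝓝 (Q y)))
    {K : X →L[𝕜] Y} (hK : IsCompactOperator K) :
    Tendsto (fun n => P n ∘L K) atTop (𝓝 (Q ∘L K)) := by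
  refine (UniformConvergenceCLM.tendsto_iff_tendstoUniformlyOn (.id 𝕜) Z
    {s | Bornology.IsVonNBounded 𝕜 s}).2 fun s hs => ?_
  obtain ⟨M, hM, hKM⟩ := hK.image_subset_compact_of_isVonNBounded hs
  exact ((tendstoUniformlyOn_of_forall_tendsto_of_isCompact hP hM).comp K).mono
    (Set.image_subset_iff.1 hKM)

end StrongConvergence

/-! ### Finite sections -/

section FiniteSections

variable {𝕜 H ι : Type*} [RCLike 𝕜] [NormedAddCommGroup H] [InnerProductSpace 𝕜 H] [Fintype ι]

variable (𝕜) in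
/-- The operator `x ↦ ∑ i, ⟪b i, x⟫ • b i`, that is, the orthogonal projection onto the span of `b`
if `b` is orthonormal. -/
def coordProj (b : ι → H) : H →L[𝕜] H := ∑ i, InnerProductSpace.rankOne 𝕜 (b i) (b i)

/-- The matrix of the compression of `T` to the span of an orthonormal family `b`; the finite
sections of an infinite matrix are of this form. -/
def compression (b : ι → H) (T : H →L[𝕜] H) : Matrix ι ι 𝕜 := .of fun i j => inner 𝕜 (b i) (T (b j))

theorem coordProj_apply (b : ι → H) (x : H) :
    coordProj 𝕜 b x = Fintype.linearCombination 𝕜 b fun i => inner 𝕜 (b i) x := by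
  simp [coordProj, Fintype.linearCombination_apply]

theorem coordProj_apply_linearCombination (b : ι → H) (T : H →L[𝕜] H) (v : ι → 𝕜) :
    coordProj 𝕜 b (T (Fintype.linearCombination 𝕜 b v)) =
      Fintype.linearCombination 𝕜 b ((compression b T).mulVec v) := by
  rw [coordProj_apply]
  congr 1
  ext i
  simp [Fintype.linearCombination_apply, compression, Matrix.mulVec, dotProduct, inner_sum,
    inner_smul_right, mul_comm]

theorem norm_linearCombination {b : ι → H} (hb : Orthonormal 𝕜 b) (v : ι → 𝕜) :
    ‖Fintype.linearCombination 𝕜 b v‖ = ‖WithLp.toLp 2 v‖ := by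
  have hsq : ‖∑ i, v i • b i‖ ^ 2 = ∑ i, ‖v i‖ ^ 2 := by
    rw [← RCLike.ofReal_inj (K := 𝕜), RCLike.ofReal_pow, ← inner_self_eq_norm_sq_to_K,
      hb.inner_sum]
    simp [RCLike.conj_mul]
  rw [EuclideanSpace.norm_eq, ← hsq, Real.sqrt_sq (norm_nonneg _),
    Fintype.linearCombination_apply]

theorem hasEigenvalue_toLin'_compression [DecidableEq ι] {b : ι → H} (hb : LinearIndependent 𝕜 b)
    {T : H →L[𝕜] H} {w : 𝕜} (hw : w ≠ 0)
    (h : Module.End.HasEigenvalue (coordProj 𝕜 b ∘L T : H →L[𝕜] H).toLinearMap w) :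
    Module.End.HasEigenvalue (Matrix.toLin' (compression b T)) w := by
  obtain ⟨u, hu⟩ := h.exists_hasEigenvector
  have hPTu : coordProj 𝕜 b (T u) = w • u := hu.apply_eq_smul
  obtain ⟨v, rfl⟩ : ∃ v, Fintype.linearCombination 𝕜 b v = u :=
    ⟨w⁻¹ • fun i => inner 𝕜 (b i) (T u), by
      rw [map_smul, ← coordProj_apply, hPTu, inv_smul_smul₀ hw]⟩
  refine Module.End.hasEigenvalue_of_hasEigenvector (x := v)
    ⟨Module.End.mem_eigenspace_iff.2 ?_, ?_⟩
  · apply hb.fintypeLinearCombination_injective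
    rw [Matrix.toLin'_apply, ← coordProj_apply_linearCombination, hPTu, map_smul]
  · rintro rfl
    exact hu.2 (map_zero _)

theorem norm_apply_linearCombination_sub_smul_le [DecidableEq ι] {b : ι → H} (hb : Orthonormal 𝕜 b)
    (T : H →L[𝕜] H) (z : 𝕜) (v : ι → 𝕜) :
    ‖T (Fintype.linearCombination 𝕜 b v) - z • Fintype.linearCombination 𝕜 b v‖ ≤
      ‖WithLp.toLp 2 ((z • 1 - compression b T).mulVec v)‖ +
        ‖coordProj 𝕜 b ∘L T - T‖ * ‖WithLp.toLp 2 v‖ := by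
  rw [← norm_linearCombination hb, ← norm_linearCombination hb]
  set u := Fintype.linearCombination 𝕜 b v with hu
  have hsplit : T u - z • u = -(Fintype.linearCombination 𝕜 b
      ((z • 1 - compression b T).mulVec v) + (coordProj 𝕜 b ∘L T - T) u) := by
    rw [Matrix.sub_mulVec, map_sub, ← coordProj_apply_linearCombination, Matrix.smul_mulVec,
      Matrix.one_mulVec, map_smul, ← hu]
    simp
  rw [hsplit, norm_neg]
  exact (norm_add_le _ _).trans (add_le_add_right (ContinuousLinearMap.le_opNorm _ _) _)

theorem tendsto_coordProj_comp_of_isCompactOperator [CompleteSpace H] (e : HilbertBasis ℕ 𝕜 H)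
    {T : H →L[𝕜] H} (hT : IsCompactOperator T) :
    Tendsto (fun n => coordProj 𝕜 (fun i : Fin n => e i) ∘L T) atTop (𝓝 T) := by
  refine tendsto_comp_of_isCompactOperator (Q := .id 𝕜 H) (fun x => ?_) hT
  convert (e.hasSum_repr x).tendsto_sum_nat using 2 with n
  · simp [coordProj_apply, Fintype.linearCombination_apply, e.repr_apply_apply, Finset.sum_range]
  · rfl

end FiniteSections

section SmallSingularValues

open scoped Matrix.Norms.Frobenius

variable {𝕜 m n : Type*} [RCLike 𝕜] [Fintype m] [Fintype n]

theorem frobenius_norm_sq (A : Matrix m n 𝕜) : ‖A‖ ^ 2 = ∑ i, ∑ j, ‖A i j‖ ^ 2 := by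
  rw [Matrix.frobenius_norm_def, ← Real.sqrt_eq_rpow, Real.sq_sqrt (by positivity)]
  simp only [Real.rpow_two]

theorem norm_toLp_mulVec_le_frobenius (A : Matrix m n 𝕜) (v : n → 𝕜) :
    ‖WithLp.toLp 2 (A.mulVec v)‖ ≤ ‖A‖ * ‖WithLp.toLp 2 v‖ := by
  have h := Matrix.frobenius_norm_mul A (Matrix.replicateCol Unit v)
  rwa [← Matrix.replicateCol_mulVec, Matrix.frobenius_norm_replicateCol,
    Matrix.frobenius_norm_replicateCol] at h

variable [DecidableEq n]

theorem norm_det_mul_norm_le (A : Matrix n n 𝕜) (v : n → 𝕜) :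
    ‖A.det‖ * ‖WithLp.toLp 2 v‖ ≤ ‖A.adjugate‖ * ‖WithLp.toLp 2 (A.mulVec v)‖ := by
  have hdet : A.det • v = A.adjugate.mulVec (A.mulVec v) := by
    rw [Matrix.mulVec_mulVec, Matrix.adjugate_mul, Matrix.smul_mulVec, Matrix.one_mulVec]
  rw [← norm_smul, ← WithLp.toLp_smul, hdet]
  exact norm_toLp_mulVec_le_frobenius _ _

theorem exists_mul_norm_mulVec_le_norm [Nonempty n] {A : Matrix n n 𝕜} {κ : ℝ}
    (h : Fintype.card n * (κ * ‖A.det‖) ^ 2 ≤ ‖A.adjugate‖ ^ 2) :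
    ∃ v ≠ 0, κ * ‖WithLp.toLp 2 (A.mulVec v)‖ ≤ ‖WithLp.toLp 2 v‖ := by
  by_cases hdet : A.det = 0
  · obtain ⟨v, hv, hAv⟩ := Matrix.exists_mulVec_eq_zero_iff.2 hdet
    exact ⟨v, hv, by simp [hAv]⟩
  obtain ⟨j, -, hj⟩ : ∃ j ∈ Finset.univ,
      (κ * ‖A.det‖) ^ 2 ≤ ‖WithLp.toLp 2 (A.adjugate.col j)‖ ^ 2 := by
    refine Finset.exists_le_of_sum_le Finset.univ_nonempty ?_
    rw [Finset.sum_const, Finset.card_univ, nsmul_eq_mul]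
    refine h.trans_eq ?_
    rw [frobenius_norm_sq, Finset.sum_comm]
    simp only [EuclideanSpace.norm_sq_eq, Matrix.col_apply]
  have hAv : A.mulVec (A.adjugate.col j) = A.det • Pi.single j 1 := by
    rw [← Matrix.mulVec_single_one, Matrix.mulVec_mulVec, Matrix.mul_adjugate, Matrix.smul_mulVec,
      Matrix.one_mulVec]
  refine ⟨A.adjugate.col j, fun h0 => ?_, ?_⟩
  · rw [h0, Matrix.mulVec_zero] at hAv
    exact hdet (by simpa using (congr_fun hAv j).symm)
  · rw [hAv]
    refine le_of_abs_le (abs_le_of_sq_le_sq ?_ (norm_nonneg _))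
    simpa [norm_smul] using hj

end SmallSingularValues

/-! ### The approximating sets -/

theorem exists_int_abs_le_abs_div_sub_le {t c : ℝ} (hc : 0 < c) {N : ℤ}
    (h : |t| * c + 1 / 2 ≤ N) : ∃ a : ℤ, |a| ≤ N ∧ |a / c - t| ≤ 1 / 2 / c := by
  have hround := abs_sub_round (t * c)
  rw [abs_sub_comm] at hround
  refine ⟨round (t * c), ?_, ?_⟩
  · have := abs_sub_abs_le_abs_sub (round (t * c) : ℝ) (t * c)
    rw [abs_mul, abs_of_pos hc] at this
    exact_mod_cast (by linarith : |(round (t * c) : ℝ)| ≤ N)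
  · rwa [div_sub' hc.ne', abs_div, abs_of_pos hc, mul_comm c, div_le_div_iff_of_pos_right hc]

/-- The point of the grid of mesh `m⁻²` with coordinates `q`. -/
def gridPoint (m : ℕ) (q : ℤ × ℤ) : ℂ := ⟨q.1 / m ^ 2, q.2 / m ^ 2⟩

/-- The coordinates of the grid points with real and imaginary parts in `[-m, m]`. -/
def gridIndices (m : ℕ) : Finset (ℤ × ℤ) :=
  Finset.Icc (-(m : ℤ) ^ 3) (m ^ 3) ×ˢ Finset.Icc (-(m : ℤ) ^ 3) (m ^ 3)

theorem exists_mem_gridIndices_norm_gridPoint_sub_le {m : ℕ} (hm : 0 < m) {w : ℂ}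
    (hw : ‖w‖ + 1 ≤ m) : ∃ q ∈ gridIndices m, ‖gridPoint m q - w‖ ≤ 1 / m ^ 2 := by
  have hm2 : (1 : ℝ) ≤ (m : ℝ) ^ 2 := one_le_pow₀ (by exact_mod_cast hm)
  have round_coord {t : ℝ} (ht : |t| ≤ ‖w‖) : ∃ a ∈ Finset.Icc (-(m : ℤ) ^ 3) (m ^ 3),
      |a / (m : ℝ) ^ 2 - t| ≤ 1 / 2 / m ^ 2 := by
    obtain ⟨a, ha, hat⟩ := exists_int_abs_le_abs_div_sub_le (t := t) (c := m ^ 2)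
      (N := (m : ℤ) ^ 3) (by positivity) (by push_cast; nlinarith)
    exact ⟨a, Finset.mem_Icc.2 (abs_le.1 ha), hat⟩
  obtain ⟨a, ha, ha'⟩ := round_coord (Complex.abs_re_le_norm w)
  obtain ⟨b, hb, hb'⟩ := round_coord (Complex.abs_im_le_norm w)
  refine ⟨(a, b), Finset.mk_mem_product ha hb, (Complex.norm_le_abs_re_add_abs_im _).trans ?_⟩
  exact (add_le_add ha' hb').trans_eq (by ring)

section ApproxSpectrum

open scoped Matrix.Norms.Frobenius

/-- The number `0` together with the grid points `z` that pass a test for being approximate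
eigenvalues of `A`. With the Frobenius norm, `‖adj (z - A)‖ / ‖det (z - A)‖` is the norm of the
inverse of `z - A`; the test compares it with a multiple of `m` and contains no division, so that it
makes sense at the eigenvalues of `A` too. -/
def approxSpectrum {m : ℕ} (A : Matrix (Fin m) (Fin m) ℂ) : Set ℂ :=
  {0} ∪ {z | ∃ q ∈ gridIndices m,
    m * (m * ‖(gridPoint m q • 1 - A).det‖) ^ 2 ≤ ‖(gridPoint m q • 1 - A).adjugate‖ ^ 2 ∧
      gridPoint m q = z}

variable {m : ℕ} {A : Matrix (Fin m) (Fin m) ℂ}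

theorem finite_approxSpectrum (A : Matrix (Fin m) (Fin m) ℂ) : (approxSpectrum A).Finite := by
  refine (Set.finite_singleton _).union
    (((gridIndices m).finite_toSet.image (gridPoint m)).subset ?_)
  rintro z ⟨q, hq, -, rfl⟩
  exact ⟨q, hq, rfl⟩

theorem exists_mem_approxSpectrum_norm_sub_le (hm : 0 < m) {w : ℂ} (hwm : ‖w‖ + 1 ≤ m)
    (hw : Module.End.HasEigenvalue (Matrix.toLin' A) w) :
    ∃ z ∈ approxSpectrum A, ‖z - w‖ ≤ 1 / m ^ 2 := by
  obtain ⟨q, hq, hqw⟩ := exists_mem_gridIndices_norm_gridPoint_sub_le hm hwm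
  refine ⟨gridPoint m q, .inr ⟨q, hq, ?_, rfl⟩, hqw⟩
  obtain ⟨v, hv⟩ := hw.exists_hasEigenvector
  have hv0 : 0 < ‖WithLp.toLp 2 v‖ := norm_pos_iff.2 ((WithLp.toLp_eq_zero 2).not.2 hv.2)
  have hAv : (gridPoint m q • 1 - A).mulVec v = (gridPoint m q - w) • v := by
    rw [Matrix.sub_mulVec, Matrix.smul_mulVec, Matrix.one_mulVec, sub_smul, ← hv.apply_eq_smul,
      Matrix.toLin'_apply]
  have hdet := norm_det_mul_norm_le (gridPoint m q • 1 - A) v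
  rw [hAv, WithLp.toLp_smul, norm_smul, ← mul_assoc, mul_le_mul_iff_left₀ hv0] at hdet
  have hm1 : (1 : ℝ) ≤ m := by exact_mod_cast hm
  calc (m : ℝ) * (m * ‖(gridPoint m q • 1 - A).det‖) ^ 2
      ≤ m * (m * (‖(gridPoint m q • 1 - A).adjugate‖ * (1 / m ^ 2))) ^ 2 := by
        gcongr
        exact hdet.trans (by gcongr)
    _ = ‖(gridPoint m q • 1 - A).adjugate‖ ^ 2 * (1 / m) := by field_simp
    _ ≤ ‖(gridPoint m q • 1 - A).adjugate‖ ^ 2 :=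
        mul_le_of_le_one_right (by positivity) ((div_le_one (by positivity)).2 hm1)

theorem exists_mul_norm_mulVec_le_norm_of_mem_approxSpectrum (hm : 0 < m) {z : ℂ}
    (hz : z ∈ approxSpectrum A) (hz0 : z ≠ 0) :
    ∃ v ≠ 0, m * ‖WithLp.toLp 2 ((z • 1 - A).mulVec v)‖ ≤ ‖WithLp.toLp 2 v‖ := by
  obtain rfl | ⟨q, -, hq, rfl⟩ := hz
  · exact absurd rfl hz0
  have := Fin.pos_iff_nonempty.1 hm
  exact exists_mul_norm_mulVec_le_norm (by simpa using hq)

theorem exists_evaluates_approxSpectrum (m : ℕ) : ∃ p : Algorithm (Fin m × Fin m),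
    ∀ y, p.Evaluates y (approxSpectrum (.of fun i j => y (i, j))) := by
  let z (q : ℤ × ℤ) : expressible (Fin m × Fin m) :=
    ((m : ℚ) ^ 2)⁻¹ • (q.1 + q.2 * ⟨_, const_I_mem_expressible⟩)
  let A (q : ℤ × ℤ) : Matrix (Fin m) (Fin m) (expressible (Fin m × Fin m)) :=
    z q • 1 - .of fun i j => ⟨_, proj_mem_expressible (i, j)⟩
  let test (q : ℤ × ℤ) : expressible (Fin m × Fin m) := m ^ 3 • ((A q).det * star (A q).det) -
    ∑ i, ∑ j, (A q).adjugate i j * star ((A q).adjugate i j)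
  have evalAt_z (y q) : evalAt y (z q) = gridPoint m q := by
    simp [z, gridPoint, evalAt_mk, Complex.mk_eq_add_mul_I, Rat.smul_def]
    ring
  let B (y : Fin m × Fin m → ℂ) (q : ℤ × ℤ) : Matrix (Fin m) (Fin m) ℂ :=
    gridPoint m q • 1 - .of fun i j => y (i, j)
  have map_A (y q) : (evalAt y).toAlgHom.mapMatrix (A q) = B y q := by
    ext i j
    simp [A, B, Matrix.one_apply, apply_ite, evalAt_z, evalAt_mk]
  have evalAt_test (y q) : evalAt y (test q) =
      (m * (m * ‖(B y q).det‖) ^ 2 - ‖(B y q).adjugate‖ ^ 2 : ℝ) := by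
    have evalAt_det : evalAt y (A q).det = (B y q).det :=
      map_A y q ▸ AlgHom.map_det (evalAt y).toAlgHom (A q)
    have evalAt_adjugate (i j) : evalAt y ((A q).adjugate i j) = (B y q).adjugate i j :=
      map_A y q ▸ congr($(AlgHom.map_adjugate (evalAt y).toAlgHom (A q)) i j)
    simp [test, map_star, evalAt_det, evalAt_adjugate, Complex.mul_conj', frobenius_norm_sq]
    ring
  obtain ⟨p, hp⟩ :=
    Algorithm.exists_evaluates_union_selection [.rat 0] (gridIndices m).toList test z
  refine ⟨p, fun y => ?_⟩
  convert hp y using 1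
  simp [approxSpectrum, RadicalExpr.eval, evalAt_test, evalAt_z, B, -Complex.ofReal_sub, eq_comm]

end ApproxSpectrum

/-! ### Convergence -/

theorem tendsto_hausdorffEDist_of_isCompact {α X : Type*} [PseudoMetricSpace X] {l : Filter α}
    {A : α → Set X} {B : Set X} (hB : IsCompact B)
    (hAB : ∀ δ > 0, ∀ᶠ n in l, A n ⊆ Metric.thickening δ B)
    (hBA : ∀ b ∈ B, ∀ δ > 0, ∀ᶠ n in l, b ∈ Metric.thickening δ (A n)) :
    Tendsto (fun n => Metric.hausdorffEDist (A n) B) l (𝓝 0) := by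
  refine ENNReal.tendsto_nhds_zero.2 fun ε hε => ?_
  obtain ⟨δ, hδ, hδε⟩ : ∃ δ : ℝ, 0 < δ ∧ ENNReal.ofReal δ ≤ ε := by
    obtain ⟨δ, -, hδ, hδε⟩ := ENNReal.lt_iff_exists_real_btwn.1 hε
    exact ⟨δ, ENNReal.ofReal_pos.1 hδ, hδε.le⟩
  obtain ⟨t, htB, htfin, ht⟩ := hB.finite_cover_balls (half_pos hδ)
  have net : ∀ᶠ n in l, ∀ b ∈ t, b ∈ Metric.thickening (δ / 2) (A n) :=
    (eventually_all_finite htfin).2 fun b hb => hBA b (htB hb) _ (half_pos hδ)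
  filter_upwards [net, hAB δ hδ] with n hnet hsub
  refine (Metric.hausdorffEDist_le_of_mem_edist (fun a ha => ?_) fun b hb => ?_).trans hδε
  · obtain ⟨b, hb, hab⟩ := Metric.mem_thickening_iff.1 (hsub ha)
    exact ⟨b, hb, edist_dist a b ▸ ENNReal.ofReal_le_ofReal hab.le⟩
  · obtain ⟨c, hc, hbc⟩ := Set.mem_iUnion₂.1 (ht hb)
    obtain ⟨a, ha, hca⟩ := Metric.mem_thickening_iff.1 (hnet c hc)
    refine ⟨a, ha, edist_dist b a ▸ ENNReal.ofReal_le_ofReal ?_⟩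
    linarith [dist_triangle b c a, Metric.mem_ball.1 hbc]

theorem attouchWets_le_hausdorffEDist (A B : Closeds ℂ) :
    attouchWets A B ≤ Metric.hausdorffEDist (A : Set ℂ) B := by
  calc attouchWets A B
      ≤ ∑' i : ℕ, (2⁻¹ : ℝ≥0∞) ^ (i + 1) * Metric.hausdorffEDist (A : Set ℂ) B := by
        refine ENNReal.tsum_le_tsum fun i => ?_
        gcongr
        refine (min_le_right _ _).trans (iSup₂_le fun x _ => max_le ?_ ?_)
        · rw [tsub_le_iff_left, Metric.hausdorffEDist_comm]
          exact Metric.infEDist_le_infEDist_add_hausdorffEDist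
        · rw [tsub_le_iff_left]
          exact Metric.infEDist_le_infEDist_add_hausdorffEDist
    _ = Metric.hausdorffEDist (A : Set ℂ) B := by
        rw [ENNReal.tsum_mul_right, ENNReal.tsum_geometric_add_one, ENNReal.one_sub_inv_two,
          inv_inv, ENNReal.inv_mul_cancel (by norm_num) (by norm_num), one_mul]

theorem not_finiteDimensional_of_hilbertBasis {𝕜 ι E : Type*} [RCLike 𝕜] [NormedAddCommGroup E]
    [InnerProductSpace 𝕜 E] [Infinite ι] (e : HilbertBasis ι 𝕜 E) : ¬ FiniteDimensional 𝕜 E :=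
  fun _ => not_finite_iff_infinite.2 ‹_› e.orthonormal.linearIndependent.finite

section SpectralConvergence

variable {H : Type*} [NormedAddCommGroup H] [InnerProductSpace ℂ H] [CompleteSpace H]
  (e : HilbertBasis ℕ ℂ H) {T : H →L[ℂ] H}

theorem eventually_approxSpectrum_subset_thickening_spectrum (hT : IsCompactOperator T) {δ : ℝ}
    (hδ : 0 < δ) : ∀ᶠ n in atTop, approxSpectrum (compression (fun i : Fin n => e i) T) ⊆
      Metric.thickening δ (spectrum ℂ T) := by
  obtain ⟨ε, hε, happrox⟩ := exists_pos_forall_approx_eigenvector_mem_thickening_spectrum T hδ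
  have small : Tendsto (fun n : ℕ => (n : ℝ)⁻¹ + ‖coordProj ℂ (fun i : Fin n => e i) ∘L T - T‖)
      atTop (𝓝 0) := by
    simpa using tendsto_inv_atTop_nhds_zero_nat.add (tendsto_iff_norm_sub_tendsto_zero.1
      (tendsto_coordProj_comp_of_isCompactOperator e hT))
  filter_upwards [small.eventually_le_const hε, eventually_gt_atTop 0] with n hnε hn z hz
  obtain rfl | hz0 := eq_or_ne z 0
  · exact Metric.self_subset_thickening hδ _ (zero_mem_spectrum_of_isCompactOperator
      (not_finiteDimensional_of_hilbertBasis e) hT)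
  obtain ⟨v, hv, hnv⟩ := exists_mul_norm_mulVec_le_norm_of_mem_approxSpectrum hn hz hz0
  have hb : Orthonormal ℂ fun i : Fin n => e i := e.orthonormal.comp _ Fin.val_injective
  refine happrox z (Fintype.linearCombination ℂ (fun i : Fin n => e i) v) ?_ ?_
  · exact (map_ne_zero_iff _ hb.linearIndependent.fintypeLinearCombination_injective).2 hv
  · refine (norm_apply_linearCombination_sub_smul_le hb T z v).trans ?_
    rw [norm_linearCombination hb]
    refine le_trans ?_ (mul_le_mul_of_nonneg_right hnε (norm_nonneg _))
    rw [add_mul]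
    gcongr
    rwa [inv_mul_eq_div, le_div_iff₀' (by positivity)]

theorem eventually_mem_thickening_approxSpectrum (hT : IsCompactOperator T) {z : ℂ}
    (hz : z ∈ spectrum ℂ T) {δ : ℝ} (hδ : 0 < δ) : ∀ᶠ n in atTop,
      z ∈ Metric.thickening δ (approxSpectrum (compression (fun i : Fin n => e i) T)) := by
  obtain rfl | hz0 := eq_or_ne z 0
  · exact .of_forall fun n => Metric.self_subset_thickening hδ _ (.inl rfl)
  have near : ∀ᶠ n in atTop, ∃ w ∈ spectrum ℂ (coordProj ℂ (fun i : Fin n => e i) ∘L T),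
      dist w z < min (δ / 2) ‖z‖ :=
    (tendsto_coordProj_comp_of_isCompactOperator e hT).eventually
      (eventually_exists_mem_spectrum_dist_lt hT hz hz0 (by positivity))
  have mesh : Tendsto (fun n : ℕ => 1 / (n : ℝ) ^ 2) atTop (𝓝 0) :=
    tendsto_const_div_pow 1 2 two_ne_zero
  filter_upwards [near, mesh.eventually_lt_const (half_pos hδ), eventually_gt_atTop 0,
    tendsto_natCast_atTop_atTop.eventually_ge_atTop (‖z‖ + δ / 2 + 1)] with n hnear hmesh hn hnz
  obtain ⟨w, hw, hwz⟩ := hnear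
  obtain ⟨hwδ, hwz⟩ := lt_min_iff.1 hwz
  have hw0 : w ≠ 0 := by
    rintro rfl
    simp at hwz
  have eigenvalue := hasEigenvalue_toLin'_compression
    (e.orthonormal.linearIndependent.comp _ Fin.val_injective) hw0
    (((hT.clm_comp (coordProj ℂ fun i : Fin n => e i)).hasEigenvalue_iff_mem_spectrum hw0).2 hw)
  have hwn : ‖w‖ + 1 ≤ n := by linarith [norm_le_norm_add_norm_sub' w z, dist_eq_norm w z]
  obtain ⟨y, hy, hyw⟩ := exists_mem_approxSpectrum_norm_sub_le hn hwn eigenvalue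
  refine Metric.mem_thickening_iff.2 ⟨y, hy, ?_⟩
  linarith [dist_triangle_left z y w, dist_eq_norm y w, dist_comm w y]

theorem tendsto_hausdorffEDist_approxSpectrum (hT : IsCompactOperator T) :
    Tendsto (fun n => Metric.hausdorffEDist
      (approxSpectrum (compression (fun i : Fin n => e i) T)) (spectrum ℂ T)) atTop (𝓝 0) :=
  tendsto_hausdorffEDist_of_isCompact (spectrum.isCompact T)
    (fun _ => eventually_approxSpectrum_subset_thickening_spectrum e hT)
    fun _ hz _ => eventually_mem_thickening_approxSpectrum e hT hz

end SpectralConvergence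

/-! ### The index of the spectrum -/

section RankOne

variable {𝕜 X Y : Type*} [RCLike 𝕜] [NormedAddCommGroup X] [InnerProductSpace 𝕜 X]
  [NormedAddCommGroup Y] [NormedSpace 𝕜 Y]

theorem isCompactOperator_rankOne (y : Y) (x : X) :
    IsCompactOperator (InnerProductSpace.rankOne 𝕜 y x) :=
  (isCompactOperator_of_locallyCompactSpace_dom (innerSL 𝕜 x)).clm_comp
    (ContinuousLinearMap.toSpanSingleton 𝕜 y)

theorem one_mem_spectrum_rankOne_self {x : X} (hx : ‖x‖ = 1) :
    1 ∈ spectrum 𝕜 (InnerProductSpace.rankOne 𝕜 x x) := by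
  refine mem_spectrum_of_hasEigenvalue
    (Module.End.hasEigenvalue_of_hasEigenvector (x := x) ⟨?_, ?_⟩)
  · simp [inner_self_eq_norm_sq_to_K, hx]
  · exact norm_ne_zero_iff.1 (hx ▸ one_ne_zero)

end RankOne

section Index

variable {H : Type*} [NormedAddCommGroup H] [InnerProductSpace ℂ H] (e : HilbertBasis ℕ ℂ H)

theorem matrixElements_injective :
    Function.Injective (matrixElements e : (H →L[ℂ] H) → ℕ → ℕ → ℂ) := by
  intro S T h
  refine ContinuousLinearMap.ext_on (s := Set.range e)
    (Submodule.dense_iff_topologicalClosure_eq_top.2 e.dense_span) ?_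
  rintro _ ⟨j, rfl⟩
  refine e.repr.injective (lp.ext (funext fun i => ?_))
  simpa only [e.repr_apply_apply] using! congr_fun₂ h i j

theorem tendsto_matrixElements_rankOne_self :
    Tendsto (fun m (q : ℕ × ℕ) =>
      matrixElements e (InnerProductSpace.rankOne ℂ (e m) (e m)) q.1 q.2)
      atTop (Filter.pi fun _ => pure 0) := by
  refine tendsto_pi.2 fun q => tendsto_pure.2 ?_
  filter_upwards [eventually_gt_atTop q.1] with m hm
  simp [matrixElements, e.orthonormal.inner_eq_zero hm.ne]

variable [CompleteSpace H] {E : Set (H →L[ℂ] H)}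

theorem solvableWithLimits_one_closedSpectrum (hE : ∀ T ∈ E, IsCompactOperator T) :
    SolvableWithLimits e E (fun T => closedSpectrum (T : H →L[ℂ] H)) 1 := by
  let Γ : List ℕ → matrixSet e E → Closeds ℂ := fun l x =>
    match l with
    | [] => closedSpectrum x.2.choose
    | n :: _ =>
      ⟨approxSpectrum (.of fun i j : Fin n => x.1 i j), (finite_approxSpectrum _).isClosed⟩
  refine ⟨Γ, fun l hl => ?_, fun l hl x => ?_, fun T => ?_⟩
  · obtain ⟨n, rfl⟩ := List.length_eq_one_iff.1 hl
    obtain ⟨p, hp⟩ := exists_evaluates_approxSpectrum n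
    exact ⟨n, p, fun x => hp fun q => x.1 q.1 q.2⟩
  · obtain rfl : l = [] := List.length_eq_zero_iff.1 (Nat.lt_one_iff.1 hl)
    obtain ⟨hT, hx⟩ := x.2.choose_spec
    have sections (n : ℕ) : (.of fun i j : Fin n => x.1 i j) =
        compression (fun i : Fin n => e i) x.2.choose :=
      Matrix.ext fun i j => (congr_fun₂ hx i j).symm
    refine tendsto_of_tendsto_of_tendsto_of_le_of_le tendsto_const_nhds
      (tendsto_hausdorffEDist_approxSpectrum e (hE _ hT)) (fun _ => zero_le) fun n => ?_
    rw [← sections]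
    exact attouchWets_le_hausdorffEDist _ _
  · exact congrArg closedSpectrum (matrixElements_injective e (matrixOf e T).2.choose_spec.2)

theorem not_solvableWithLimits_zero_closedSpectrum
    (hE : ∀ x, InnerProductSpace.rankOne ℂ x x ∈ E) :
    ¬ SolvableWithLimits e E (fun T => closedSpectrum (T : H →L[ℂ] H)) 0 := by
  rintro ⟨p, hp⟩
  have hp0 : p.Evaluates (fun _ => 0) {0} := by
    have : Nontrivial H := ⟨e 0, 0, e.orthonormal.ne_zero 0⟩
    convert hp ⟨_, hE 0⟩ using 1
    · simp [matrixElements]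
    · simp [closedSpectrum, spectrum.zero_eq]
  obtain ⟨m, hm⟩ := ((tendsto_matrixElements_rankOne_self e).eventually hp0.eventually).exists
  have heq : spectrum ℂ (InnerProductSpace.rankOne ℂ (e m) (e m)) = {0} :=
    (hp ⟨_, hE (e m)⟩).unique hm
  have one_mem : (1 : ℂ) ∈ spectrum ℂ (InnerProductSpace.rankOne ℂ (e m) (e m)) :=
    one_mem_spectrum_rankOne_self (e.orthonormal.1 m)
  rw [heq] at one_mem
  exact one_ne_zero one_mem

end Index

end SolvabilityComplexity

end

theorem mainTheorem1_general {H : Type*} [NormedAddCommGroup H] [InnerProductSpace ℂ H]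
    [CompleteSpace H] (e : HilbertBasis ℕ ℂ H) {E : Set (H →L[ℂ] H)}
    (hcompact : ∀ T ∈ E, IsCompactOperator T)
    (hrankOne : ∀ x, InnerProductSpace.rankOne ℂ x x ∈ E) :
    SolvabilityComplexity.SCI e E
      (fun T => SolvabilityComplexity.closedSpectrum (T : H →L[ℂ] H)) = 1 := by
  refine le_antisymm (iInf₂_le_of_le 1
    (SolvabilityComplexity.solvableWithLimits_one_closedSpectrum e hcompact) Nat.cast_one.le)
    (le_iInf₂ fun k hk => ?_)
  obtain rfl | hk0 := k.eq_zero_or_pos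
  · exact absurd hk (SolvabilityComplexity.not_solvableWithLimits_zero_closedSpectrum e hrankOne)
  · exact_mod_cast hk0

theorem mainTheorem1 {H : Type*} [NormedAddCommGroup H] [InnerProductSpace ℂ H] [CompleteSpace H]
    (e : HilbertBasis ℕ ℂ H) :
    SolvabilityComplexity.SCI e {T : H →L[ℂ] H | IsCompactOperator T}
      (fun T => SolvabilityComplexity.closedSpectrum (T : H →L[ℂ] H)) = 1 :=
  mainTheorem1_general e (fun _ hT => hT)
    fun x => SolvabilityComplexity.isCompactOperator_rankOne x x
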